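/- Let $Y(x)=a_0+a_1x+\dots+a_6x^6$ be a real polynomial of degree $6$ without gaps, i.e. all $a_i\neq 0$. Its sign sequence is $\sigma=(\sigma_0,\dots,\sigma_6)$ with $\sigma_i=a_i/|a_i|$ (constant term first); $P$ and $N$ are its numbers of positive and of negative roots, counted with multiplicity. For a sequence $\sigma\in\{+,-\}^7$, a pair $(P,N)$ of non-negative integers is called *possible* if some such $Y$ has sign sequence $\sigma$ and exactly $P$ positive and $N$ negative roots. Let $v(\tau)$ be the number of pairs of consecutive opposite signs in a sequence $\tau$, and let $\sigma'_i=(-1)^i\sigma_i$. The pair $(P,N)$ is *allowed by Descartes' rule* for $\sigma$ if $v(\sigma)-P$ and $v(\sigma')-N$ are both even and non-negative. The trivial transformations $Y\mapsto -Y$, $Y(x)\mapsto Y(-x)$ and $Y(x)\mapsto x^6Y(1/x)$ act on the triples $(\sigma,P,N)$ by $(\sigma,P,N)\mapsto(-\sigma,P,N)$, $(\sigma,P,N)\mapsto(\sigma',N,P)$ and $(\sigma,P,N)\mapsto((\sigma_6,\dots,\sigma_0),P,N)$. Call $(\sigma,P,N)$ *exceptional* if a finite sequence of these transformations carries one of the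 following four triples to it: - $\sigma=(+,+,-,+,-,+,+)$ with $(P,N)=(2,0)$ or $(P,N)=(4,0)$; - $\sigma=(+,+,+,+,-,+,+)$ with $(P,N)=(2,0)$; - $\sigma=(+,+,-,-,-,-,+)$ with $(P,N)=(0,4)$. Then: 1. For every $\sigma\in\{+,-\}^7$, a pair $(P,N)$ is possible for $\sigma$ if and only if it is allowed by Descartes' rule and $(\sigma,P,N)$ is not exceptional. 2. Every exceptional triple is allowed by Descartes' rule. 3. (Grabiner's erasing rule in degree $6$.) If $S\subseteq\{1,\dots,5\}$, and $P$ and $N$ are the numbers of variations $v$ of the sequences obtained from $\sigma$ and $\sigma'$ respectively by erasing the entries with index in $S$, then $(P,N)$ is possible for $\sigma$. 4. The polynomials $$Y_1=(31+11x+x^2)(1-x)(2-x)(3-x)(4-x),\qquad Y_2=(9+8x+2x^2)(1-x)(2-x)(3-x)(4-x)$$ have sign sequences $(+,-,+,+,-,+,+)$ and $(+,-,-,+,-,-,+)$ respectively, and both have $(P,N)=(4,0)$. 5. Every triple $(\sigma,P,N)$ that is allowed by Descartes' rule and not exceptional either is obtained by the erasing rule of item 3 for some $S$, or is the sign sequence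 with the numbers of positive and negative roots of a polynomial obtained from $Y_1$ or $Y_2$ by a finite sequence of trivial transformations. -/

import Mathlib

open Polynomial

namespace SignPatterns

/-- The number of variations of a sequence of signs: the number of pairs of consecutive
entries that are opposite (and non-zero). -/
def variations (l : List SignType) : ℕ :=
  (l.zip l.tail).countP (fun p => p.1 * p.2 = -1)

/-- A sign sequence `σ_0, …, σ_n` (the sign of the constant term comes first), together with
a pair `(P, N)` of prescribed numbers of positive and negative roots. -/
@[ext]
structure Config (n : ℕ) where
  signs : Fin (n + 1) → SignType
  pos : ℕ
  neg : ℕ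

/-- There is no gap: no sign in the sequence is zero. -/
def Gapless {n : ℕ} (c : Config n) : Prop := ∀ i, c.signs i ≠ 0

/-- The modified sequence `σ_i (-1)^i`, which is the sign sequence of `Y(-x)`. -/
def alternate {n : ℕ} (σ : Fin (n + 1) → SignType) : Fin (n + 1) → SignType :=
  fun i => (-1) ^ (i : ℕ) * σ i

/-- The cardinality of the multiset of positive roots (roots counted with multiplicity). -/
noncomputable def numPos (Y : ℝ[X]) : ℕ := Y.roots.countP (fun x => 0 < x)

/-- The cardinality of the multiset of negative roots (roots counted with multiplicity). -/
noncomputable def numNeg (Y : ℝ[X]) : ℕ := Y.roots.countP (fun x => x < 0)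

/-- `Y` has degree `n`, its coefficients have the prescribed signs, and it has exactly `P`
positive and `N` negative roots, counted with multiplicity. -/
def Realizes {n : ℕ} (Y : ℝ[X]) (c : Config n) : Prop :=
  Y.natDegree = n ∧ (∀ i : Fin (n + 1), SignType.sign (Y.coeff i) = c.signs i) ∧
    numPos Y = c.pos ∧ numNeg Y = c.neg

/-- The pair `(P, N)` is possible for the sign sequence. -/
def Possible {n : ℕ} (c : Config n) : Prop := ∃ Y : ℝ[X], Realizes Y c

/-- The pair `(P, N)` is allowed by Descartes' rule, applied to `Y(x)` and to `Y(-x)`: `P` is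
at most the number of variations of the sign sequence and has the same parity, and `N` is at
most the number of variations of the modified sequence and has the same parity. -/
def DescartesAllows {n : ℕ} (c : Config n) : Prop :=
  (c.pos ≤ variations (List.ofFn c.signs) ∧
    Even (variations (List.ofFn c.signs) - c.pos)) ∧
  (c.neg ≤ variations (List.ofFn (alternate c.signs)) ∧
    Even (variations (List.ofFn (alternate c.signs)) - c.neg))

/-- The sequence that remains after the entries with index in `S` have been erased. -/
def erase {n : ℕ} (S : Finset (Fin (n + 1))) (σ : Fin (n + 1) → SignType) : List SignType :=
  ((List.finRange (n + 1)).filter (fun i => i ∉ S)).map σ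

/-- Grabiner's erasing rule: for some set of indices that contains neither the first nor the
last one, `P` and `N` are the numbers of variations of the sign sequence and of the modified
sequence after the entries with these indices have been erased from both. -/
def ErasingRule {n : ℕ} (c : Config n) : Prop :=
  ∃ S : Finset (Fin (n + 1)), 0 ∉ S ∧ Fin.last n ∉ S ∧
    c.pos = variations (erase S c.signs) ∧
    c.neg = variations (erase S (alternate c.signs))

/-- The effect on a sign sequence and a pair `(P, N)` of one of the trivial transformations
`Y ↦ -Y`, `x ↦ -x` and `x ↦ 1/x`. -/
inductive Config.Step {n : ℕ} : Config n → Config n → Prop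
  | negate (c : Config n) : Config.Step c ⟨fun i => -c.signs i, c.pos, c.neg⟩
  | reflect (c : Config n) : Config.Step c ⟨alternate c.signs, c.neg, c.pos⟩
  | invert (c : Config n) : Config.Step c ⟨fun i => c.signs i.rev, c.pos, c.neg⟩

/-- `d` is obtained from `c` by a finite sequence of trivial transformations. -/
def Config.Analogue {n : ℕ} (c d : Config n) : Prop :=
  Relation.ReflTransGen Config.Step c d

/-- One of the trivial transformations `Y ↦ -Y`, `Y(x) ↦ Y(-x)` and `Y(x) ↦ x^m Y(1/x)` with
`m` the degree of `Y`, on polynomials. -/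
inductive PolyStep : ℝ[X] → ℝ[X] → Prop
  | negate (Y : ℝ[X]) : PolyStep Y (-Y)
  | reflect (Y : ℝ[X]) : PolyStep Y (Y.comp (-X))
  | invert (Y : ℝ[X]) : PolyStep Y Y.reverse

/-- `Z` is obtained from `Y` by a finite sequence of trivial transformations. -/
def PolyAnalogue (Y Z : ℝ[X]) : Prop := Relation.ReflTransGen PolyStep Y Z

/-- The four listed impossibilities in degree 6. -/
def listed : List (Config 6) :=
  [⟨![1, 1, -1, 1, -1, 1, 1], 2, 0⟩,
   ⟨![1, 1, -1, 1, -1, 1, 1], 4, 0⟩,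
   ⟨![1, 1, 1, 1, -1, 1, 1], 2, 0⟩,
   ⟨![1, 1, -1, -1, -1, -1, 1], 0, 4⟩]

/-- Trivially equivalent to one of the four listed impossibilities. -/
def Exceptional (c : Config 6) : Prop := ∃ e ∈ listed, Config.Analogue e c

/-- `744 - 1286 x + 559 x^2 + 25 x^3 - 44 x^4 + x^5 + x^6`. -/
noncomputable def explicitPoly₁ : ℝ[X] :=
  (31 + 11 * X + X ^ 2) * (1 - X) * (2 - X) * (3 - X) * (4 - X)

/-- `216 - 258 x - 37 x^2 + 90 x^3 - x^4 - 12 x^5 + 2 x^6`. -/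
noncomputable def explicitPoly₂ : ℝ[X] :=
  (9 + 8 * X + 2 * X ^ 2) * (1 - X) * (2 - X) * (3 - X) * (4 - X)

end SignPatterns

namespace SignPatterns

/-! ### Root counts and trivial transformations -/

/-! The trivial transformations turn realizing polynomials into realizing polynomials, and each is
an involution, so possibility is constant on orbits. This makes it enough to refute the four listed
triples and to realize one member of every other allowed orbit.

Necessity: the bound in Descartes' rule is Mathlib's; the parity compares the signs of the constant
and leading coefficients (`sign_coeff_zero`). The first three listed triples have a positive
constant term and positive odd coefficients, so a positive root `r` gives `Y(-r) < 0 < Y(0)` and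
hence a negative root, contrary to `N = 0`. In the fourth, `Y` is a quartic with four negative roots
times a quadratic of negative discriminant, and the signs of the coefficients of `x^5` and `x^2`
contradict an inequality of Newton type (`not_quadratic_mul_quartic`).

Sufficiency: a table of products of integral linear factors and definite quadratics covers all
remaining orbits. Root counts are read off the factors, coefficient signs come from integer list
arithmetic, and the kernel checks coverage (`exists_witness`).

The erasing rule needs no perturbation argument: its outputs are allowed and never exceptional, by
enumeration, hence possible by the classification. Item 5 is another finite check. -/

theorem numPos_neg (Y : ℝ[X]) : numPos (-Y) = numPos Y := by
  simp [numPos, roots_neg]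

theorem numNeg_neg (Y : ℝ[X]) : numNeg (-Y) = numNeg Y := by
  simp [numNeg, roots_neg]

theorem numPos_comp_neg_X (Y : ℝ[X]) : numPos (Y.comp (-X)) = numNeg Y := by
  rw [numPos, numNeg, roots_comp_neg_X, Multiset.countP_map, ← Multiset.countP_eq_card_filter]
  simp only [neg_pos]

theorem numNeg_comp_neg_X (Y : ℝ[X]) : numNeg (Y.comp (-X)) = numPos Y := by
  rw [numNeg, numPos, roots_comp_neg_X, Multiset.countP_map, ← Multiset.countP_eq_card_filter]
  simp only [neg_lt_zero]

theorem reverse_X_sub_C {a : ℝ} (ha : a ≠ 0) :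
    (X - C a).reverse = C (-a) * (X - C a⁻¹) := by
  have h := reverse_add_C (X : ℝ[X]) (-a)
  have h1 : (X : ℝ[X]).reverse = 1 := by
    rw [← one_mul X, reverse_mul_X, ← C_1, reverse_C]
  rw [C_neg, ← sub_eq_add_neg] at h
  rw [h, h1, natDegree_X]
  have : C a * C a⁻¹ = (1 : ℝ[X]) := by rw [← C_mul, mul_inv_cancel₀ ha, C_1]
  rw [C_neg]
  linear_combination -this

theorem roots_reverse_eq_zero {q : ℝ[X]} (h0 : q.coeff 0 ≠ 0) (h : q.roots = 0) :
    q.reverse.roots = 0 := by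
  have hq : q ≠ 0 := by rintro rfl; simp at h0
  refine Multiset.eq_zero_of_forall_notMem fun x hx => ?_
  have hx' : q.reverse.eval x = 0 := (mem_roots'.1 hx).2
  rcases eq_or_ne x 0 with rfl | hx0
  · rw [← coeff_zero_eq_eval_zero, coeff_zero_reverse, leadingCoeff_eq_zero] at hx'
    exact hq hx'
  · have hmem : x⁻¹ ∈ q.roots := by
      rw [mem_roots hq, IsRoot.def]
      let _ : Invertible x⁻¹ := invertibleOfNonzero (inv_ne_zero hx0)
      have := eval₂_reverse_eq_zero_iff (RingHom.id ℝ) x⁻¹ q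
      rw [invOf_eq_inv, inv_inv] at this
      exact this.1 hx'
    simp [h] at hmem

/-- The roots of `x ^ deg Y * Y(1/x)` are the inverses of the roots of `Y`, with the same
multiplicities. -/
theorem roots_reverse {Y : ℝ[X]} (h0 : Y.coeff 0 ≠ 0) :
    Y.reverse.roots = Y.roots.map (·⁻¹) := by
  obtain ⟨q, hq, -, hqr⟩ := exists_prod_multiset_X_sub_C_mul Y
  have hY : Y ≠ 0 := by rintro rfl; simp at h0
  have hs : ∀ a ∈ Y.roots, a ≠ 0 := by
    rintro a ha rfl
    exact h0 (by rw [coeff_zero_eq_eval_zero]; exact (mem_roots'.1 ha).2)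
  -- The induction runs over an arbitrary multiset of nonzero numbers, since `Y.roots` is tied to
  -- `Y`. Each factor `x - a` reverses to `-a (x - a⁻¹)`, which contributes the root `a⁻¹`.
  have key : ∀ s : Multiset ℝ, (∀ a ∈ s, a ≠ 0) → ∀ q : ℝ[X], q.coeff 0 ≠ 0 → q.roots = 0 →
      ((s.map fun a => X - C a).prod * q).reverse.roots = s.map (·⁻¹) := by
    intro s
    induction s using Multiset.induction with
    | empty => intro _ q hq hqr; simpa using roots_reverse_eq_zero hq hqr
    | cons a s ih =>
      intro hs q hq hqr
      have ha := hs a (Multiset.mem_cons_self _ _)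
      have hne : q ≠ 0 := by rintro rfl; simp at hq
      have hne' : ((s.map fun a => X - C a).prod * q).reverse ≠ 0 := by
        rw [Ne, reverse_eq_zero]
        exact mul_ne_zero (Multiset.prod_ne_zero fun h => by
          obtain ⟨b, -, hb⟩ := Multiset.mem_map.1 h
          exact X_sub_C_ne_zero b hb) hne
      rw [Multiset.map_cons, Multiset.prod_cons, mul_assoc, reverse_mul_of_domain,
        reverse_X_sub_C ha, mul_assoc, roots_C_mul _ (neg_ne_zero.2 ha),
        roots_mul (mul_ne_zero (X_sub_C_ne_zero _) hne'), roots_X_sub_C,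
        ih (fun b hb => hs b (Multiset.mem_cons_of_mem hb)) q hq hqr, Multiset.map_cons,
        Multiset.singleton_add]
  have hq0 : q.coeff 0 ≠ 0 := by
    intro h
    apply h0
    rw [← hq, mul_coeff_zero, h, mul_zero]
  rw [← hq] at hs
  conv_lhs => rw [← hq]
  exact key _ (by rwa [hq] at hs) q hq0 hqr

theorem numPos_reverse {Y : ℝ[X]} (h0 : Y.coeff 0 ≠ 0) : numPos Y.reverse = numPos Y := by
  rw [numPos, numPos, roots_reverse h0, Multiset.countP_map, ← Multiset.countP_eq_card_filter]
  simp only [inv_pos]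

theorem numNeg_reverse {Y : ℝ[X]} (h0 : Y.coeff 0 ≠ 0) : numNeg Y.reverse = numNeg Y := by
  rw [numNeg, numNeg, roots_reverse h0, Multiset.countP_map, ← Multiset.countP_eq_card_filter]
  simp only [inv_lt_zero]

/-! ### Action of the trivial transformations on configurations -/

def Config.negate {n : ℕ} (c : Config n) : Config n := ⟨fun i => -c.signs i, c.pos, c.neg⟩

def Config.reflect {n : ℕ} (c : Config n) : Config n := ⟨alternate c.signs, c.neg, c.pos⟩

def Config.invert {n : ℕ} (c : Config n) : Config n := ⟨fun i => c.signs i.rev, c.pos, c.neg⟩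

theorem Realizes.negate {n : ℕ} {Y : ℝ[X]} {c : Config n} (h : Realizes Y c) :
    Realizes (-Y) c.negate := by
  obtain ⟨hd, hs, hP, hN⟩ := h
  refine ⟨by rw [natDegree_neg, hd], fun i => ?_, by rw [numPos_neg, hP]; rfl,
    by rw [numNeg_neg, hN]; rfl⟩
  rw [coeff_neg, Left.sign_neg, hs]; rfl

theorem sign_neg_one_pow (i : ℕ) : SignType.sign ((-1 : ℝ) ^ i) = (-1) ^ i := by
  rw [sign_pow]; simp

theorem Realizes.reflect {n : ℕ} {Y : ℝ[X]} {c : Config n} (h : Realizes Y c) :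
    Realizes (Y.comp (-X)) c.reflect := by
  obtain ⟨hd, hs, hP, hN⟩ := h
  refine ⟨by rw [natDegree_comp, natDegree_neg, natDegree_X, mul_one, hd], fun i => ?_,
    by rw [numPos_comp_neg_X, hN]; rfl, by rw [numNeg_comp_neg_X, hP]; rfl⟩
  rw [show (-X : ℝ[X]) = C (-1) * X by simp, comp_C_mul_X_coeff, mul_comm, sign_mul, sign_neg_one_pow, hs]; rfl

theorem Realizes.coeff_zero_ne_zero {n : ℕ} {Y : ℝ[X]} {c : Config n} (h : Realizes Y c)
    (hc : Gapless c) : Y.coeff 0 ≠ 0 := by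
  have := h.2.1 0
  intro h0
  rw [Fin.val_zero, h0, sign_zero] at this
  exact hc 0 this.symm

theorem Realizes.invert {n : ℕ} {Y : ℝ[X]} {c : Config n} (h : Realizes Y c)
    (hc : Gapless c) : Realizes Y.reverse c.invert := by
  have h0 := h.coeff_zero_ne_zero hc
  obtain ⟨hd, hs, hP, hN⟩ := h
  refine ⟨?_, fun i => ?_, by rw [numPos_reverse h0, hP]; rfl, by rw [numNeg_reverse h0, hN]; rfl⟩
  · rw [reverse_natDegree, natTrailingDegree_eq_zero.2 (Or.inr h0), hd, Nat.sub_zero]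
  · rw [coeff_reverse, hd, revAt_le (by omega)]
    have := hs i.rev
    rw [Fin.val_rev] at this
    simpa [Config.invert] using this

theorem Gapless.negate {n : ℕ} {c : Config n} (hc : Gapless c) : Gapless c.negate := fun i => by
  have := hc i
  simp only [Config.negate]
  revert this
  generalize c.signs i = s
  revert s
  decide

theorem alternate_ne_zero {n : ℕ} {σ : Fin (n + 1) → SignType} {i : Fin (n + 1)} (h : σ i ≠ 0) :
    alternate σ i ≠ 0 :=
  mul_ne_zero (pow_ne_zero _ (by decide)) h

theorem Gapless.reflect {n : ℕ} {c : Config n} (hc : Gapless c) : Gapless c.reflect :=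
  fun i => alternate_ne_zero (hc i)

theorem Gapless.invert {n : ℕ} {c : Config n} (hc : Gapless c) : Gapless c.invert :=
  fun i => hc i.rev

theorem Config.Step.gapless {n : ℕ} {c d : Config n} (h : Config.Step c d) (hc : Gapless c) :
    Gapless d := by
  cases h with
  | negate => exact hc.negate
  | reflect => exact hc.reflect
  | invert => exact hc.invert

/-- A trivial transformation of configurations is covered by one of polynomials. -/
theorem Config.Step.exists_polyStep {n : ℕ} {c d : Config n} (h : Config.Step c d)
    (hc : Gapless c) {Y : ℝ[X]} (hY : Realizes Y c) : ∃ Z, PolyStep Y Z ∧ Realizes Z d := by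
  cases h with
  | negate => exact ⟨_, .negate Y, hY.negate⟩
  | reflect => exact ⟨_, .reflect Y, hY.reflect⟩
  | invert => exact ⟨_, .invert Y, hY.invert hc⟩

theorem Config.Analogue.exists_polyAnalogue {n : ℕ} {c d : Config n} (h : Config.Analogue c d)
    (hc : Gapless c) {Y : ℝ[X]} (hY : Realizes Y c) :
    Gapless d ∧ ∃ Z, PolyAnalogue Y Z ∧ Realizes Z d := by
  induction h with
  | refl => exact ⟨hc, Y, .refl, hY⟩
  | tail _ hs ih =>
    obtain ⟨hg, Z, hZ, hr⟩ := ih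
    obtain ⟨W, hW, hr'⟩ := hs.exists_polyStep hg hr
    exact ⟨hs.gapless hg, W, hZ.tail hW, hr'⟩

theorem Config.Analogue.gapless {n : ℕ} {c d : Config n} (h : Config.Analogue c d)
    (hc : Gapless c) : Gapless d := by
  induction h with
  | refl => exact hc
  | tail _ hs ih => exact hs.gapless ih

theorem Config.Analogue.possible {n : ℕ} {c d : Config n} (h : Config.Analogue c d)
    (hc : Gapless c) (hp : Possible c) : Possible d := by
  obtain ⟨Y, hY⟩ := hp
  obtain ⟨-, Z, -, hZ⟩ := h.exists_polyAnalogue hc hY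
  exact ⟨Z, hZ⟩

/-- All three transformations are involutions. This lets realizability be transported backwards
along a chain of steps. -/
theorem Config.Step.symm {n : ℕ} {c d : Config n} (h : Config.Step c d) : Config.Step d c := by
  cases h with
  | negate =>
    convert Config.Step.negate (n := n) _ using 1
    ext i <;> simp
  | reflect =>
    convert Config.Step.reflect (n := n) _ using 1
    refine Config.ext (funext fun i => ?_) rfl rfl
    simp only [alternate]
    rw [← mul_assoc, ← mul_pow, show (-1 : SignType) * -1 = 1 from rfl, one_pow, one_mul]
  | invert =>
    convert Config.Step.invert (n := n) _ using 1
    ext i <;> simp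

theorem Config.Analogue.symm {n : ℕ} {c d : Config n} (h : Config.Analogue c d) :
    Config.Analogue d c := by
  induction h with
  | refl => exact .refl
  | tail _ hs ih => exact Relation.ReflTransGen.head hs.symm ih

/-! ### Descartes' rule of signs with parity -/

/-- By the intermediate value theorem, a polynomial without real roots has at 0 the sign that it has
near `+∞`. -/
theorem sign_eval_zero_of_roots_eq_zero {q : ℝ[X]} (hq : q.roots = 0) :
    SignType.sign (q.eval 0) = SignType.sign q.leadingCoeff := by
  have pos : ∀ q : ℝ[X], q.roots = 0 → 0 < q.leadingCoeff → 0 < q.eval 0 := by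
    intro q hq hl
    have hq0 : q ≠ 0 := leadingCoeff_ne_zero.1 hl.ne'
    rcases Nat.eq_zero_or_pos q.natDegree with hd | hd
    · rw [eq_C_of_natDegree_eq_zero hd] at hl ⊢
      simpa using hl
    · by_contra! h
      obtain ⟨x, hx⟩ := ((q.tendsto_atTop_of_leadingCoeff_nonneg
        (natDegree_pos_iff_degree_pos.1 hd) hl.le).eventually_ge_atTop 0).exists
      obtain ⟨y, hy⟩ := mem_range_of_exists_le_of_exists_ge q.continuous ⟨0, h⟩ ⟨x, hx⟩
      have : y ∈ q.roots := (mem_roots hq0).2 hy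
      simp [hq] at this
  rcases lt_trichotomy q.leadingCoeff 0 with h | h | h
  · have := pos (-q) (by rwa [roots_neg]) (by rwa [leadingCoeff_neg, neg_pos])
    rw [eval_neg, neg_pos] at this
    rw [sign_neg h, sign_neg this]
  · rw [leadingCoeff_eq_zero.1 h]; simp
  · rw [sign_pos h, sign_pos (pos q hq h)]

/-- Split off all real roots: a factor `x - a` has the sign of `-a` at 0 and leading coefficient 1,
so exactly the positive roots flip the sign; the cofactor has no real roots. -/
theorem sign_coeff_zero {Y : ℝ[X]} (h0 : Y.coeff 0 ≠ 0) :
    SignType.sign (Y.coeff 0) = (-1) ^ numPos Y * SignType.sign Y.leadingCoeff := by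
  obtain ⟨q, hq, -, hqr⟩ := exists_prod_multiset_X_sub_C_mul Y
  have key : ∀ s : Multiset ℝ, (∀ a ∈ s, a ≠ 0) →
      SignType.sign (((s.map fun a => X - C a).prod * q).eval 0) =
        (-1) ^ s.countP (fun x => 0 < x) *
          SignType.sign ((s.map fun a => X - C a).prod * q).leadingCoeff := by
    intro s
    induction s using Multiset.induction with
    | empty => intro _; simpa using sign_eval_zero_of_roots_eq_zero hqr
    | cons a s ih =>
      intro hs
      rw [Multiset.map_cons, Multiset.prod_cons, mul_assoc, eval_mul, sign_mul,
        ih fun b hb => hs b (Multiset.mem_cons_of_mem hb), leadingCoeff_mul (X - C a),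
        leadingCoeff_X_sub_C, one_mul, eval_sub, eval_X, eval_C, zero_sub, Left.sign_neg]
      rcases (hs a (Multiset.mem_cons_self _ _)).lt_or_gt with ha | ha
      · rw [Multiset.countP_cons_of_neg _ (not_lt.2 ha.le), sign_neg ha, neg_neg, one_mul]
      · rw [Multiset.countP_cons_of_pos _ ha, sign_pos ha, pow_succ', mul_assoc]
  have := key Y.roots (by
    rintro a ha rfl
    exact h0 (by rw [coeff_zero_eq_eval_zero]; exact (mem_roots'.1 ha).2))
  rwa [hq, ← coeff_zero_eq_eval_zero] at this

/-! ### Enumeration of gapless sign sequences and the parity in Descartes' rule -/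

def nonzeroSigns : List SignType := [1, -1]

theorem mem_nonzeroSigns {s : SignType} (h : s ≠ 0) : s ∈ nonzeroSigns := by
  revert h; revert s; decide

/-- Reduces a statement on gapless sequences to 128 explicit vectors, a form that the kernel can
evaluate. -/
theorem forall_gapless {Q : (Fin 7 → SignType) → Prop}
    (h : ∀ a ∈ nonzeroSigns, ∀ b ∈ nonzeroSigns, ∀ c ∈ nonzeroSigns, ∀ d ∈ nonzeroSigns,
      ∀ e ∈ nonzeroSigns, ∀ f ∈ nonzeroSigns, ∀ g ∈ nonzeroSigns, Q ![a, b, c, d, e, f, g])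
    (σ : Fin 7 → SignType) (hσ : ∀ i, σ i ≠ 0) : Q σ := by
  have : σ = ![σ 0, σ 1, σ 2, σ 3, σ 4, σ 5, σ 6] := by
    funext i; fin_cases i <;> rfl
  rw [this]
  have m := fun i => mem_nonzeroSigns (hσ i)
  exact h _ (m 0) _ (m 1) _ (m 2) _ (m 3) _ (m 4) _ (m 5) _ (m 6)

theorem neg_one_pow_variations (σ : Fin 7 → SignType) (hσ : ∀ i, σ i ≠ 0) :
    (-1) ^ variations (List.ofFn σ) * σ 6 = σ 0 :=
  forall_gapless (Q := fun σ => (-1) ^ variations (List.ofFn σ) * σ 6 = σ 0)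
    (by decide +kernel) σ hσ

/-- The left side is how Mathlib's `signVariations` counts: leading coefficient first, zeros
dropped, repetitions collapsed. -/
theorem length_destutter_eq_variations (σ : Fin 7 → SignType) (hσ : ∀ i, σ i ≠ 0) :
    (((List.ofFn σ).reverse.filter (· ≠ 0)).destutter (· ≠ ·)).length - 1 =
      variations (List.ofFn σ) :=
  forall_gapless (Q := fun σ =>
    (((List.ofFn σ).reverse.filter (· ≠ 0)).destutter (· ≠ ·)).length - 1 =
      variations (List.ofFn σ)) (by decide +kernel) σ hσ

theorem map_sign_coeffList {n : ℕ} {Y : ℝ[X]} {c : Config n} (h : Realizes Y c) (hY : Y ≠ 0) :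
    Y.coeffList.map SignType.sign = (List.ofFn c.signs).reverse := by
  have h1 : Y.degree.succ = n + 1 := by
    rw [degree_eq_natDegree hY, h.1]; rfl
  have h2 : List.ofFn c.signs = (List.range (n + 1)).map fun i => SignType.sign (Y.coeff i) := by
    refine List.ext_getElem (by simp) fun i hi _ => ?_
    rw [List.length_ofFn] at hi
    rw [List.getElem_ofFn, List.getElem_map, List.getElem_range]
    exact (h.2.1 ⟨i, hi⟩).symm
  rw [coeffList, h1, h2, List.map_reverse, List.map_reverse, List.map_map]
  rfl

theorem Realizes.ne_zero {n : ℕ} {Y : ℝ[X]} {c : Config n} (h : Realizes Y c) (hc : Gapless c) :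
    Y ≠ 0 := by
  rintro rfl
  simpa using h.coeff_zero_ne_zero hc

/-- For the parity, `σ_0 = (-1)^P σ_6` by counting roots and `σ_0 = (-1)^v σ_6` by counting
variations. The negative roots are handled by applying this to `Y(-x)`. -/
theorem Realizes.descartes_pos {Y : ℝ[X]} {c : Config 6} (h : Realizes Y c) (hc : Gapless c) :
    c.pos ≤ variations (List.ofFn c.signs) ∧
      Even (variations (List.ofFn c.signs) - c.pos) := by
  have hY := h.ne_zero hc
  have hle : c.pos ≤ variations (List.ofFn c.signs) := by
    rw [← h.2.2.1, ← length_destutter_eq_variations _ hc, ← map_sign_coeffList h hY]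
    exact roots_countP_pos_le_signVariations Y
  refine ⟨hle, ?_⟩
  have h1 := sign_coeff_zero (h.coeff_zero_ne_zero hc)
  have h2 : SignType.sign Y.leadingCoeff = c.signs 6 := by
    rw [leadingCoeff, h.1]; exact h.2.1 6
  have h3 : SignType.sign (Y.coeff 0) = c.signs 0 := h.2.1 0
  rw [h2, h3, h.2.2.1, ← neg_one_pow_variations _ hc] at h1
  have h4 := mul_right_cancel₀ (hc 6) h1
  rw [Nat.even_sub hle]
  rcases Nat.even_or_odd (variations (List.ofFn c.signs)) with hv | hv <;>
    rcases Nat.even_or_odd c.pos with hp | hp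
  · exact iff_of_true hv hp
  · rw [hv.neg_one_pow, hp.neg_one_pow] at h4; exact absurd h4 (by decide)
  · rw [hv.neg_one_pow, hp.neg_one_pow] at h4; exact absurd h4 (by decide)
  · exact iff_of_false (Nat.not_even_iff_odd.2 hv) (Nat.not_even_iff_odd.2 hp)

theorem Possible.descartesAllows {c : Config 6} (h : Possible c) (hc : Gapless c) :
    DescartesAllows c := by
  obtain ⟨Y, hY⟩ := h
  exact ⟨hY.descartes_pos hc, hY.reflect.descartes_pos hc.reflect⟩

/-! ### The impossible configurations -/

theorem Realizes.coeff_pos {n : ℕ} {Y : ℝ[X]} {c : Config n} (h : Realizes Y c)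
    (i : Fin (n + 1)) (hi : c.signs i = 1) : 0 < Y.coeff i :=
  sign_eq_one_iff.1 ((h.2.1 i).trans hi)

theorem Realizes.coeff_neg {n : ℕ} {Y : ℝ[X]} {c : Config n} (h : Realizes Y c)
    (i : Fin (n + 1)) (hi : c.signs i = -1) : Y.coeff i < 0 :=
  sign_eq_neg_one_iff.1 ((h.2.1 i).trans hi)

/-- If the constant term and the odd coefficients are positive and there are no negative roots,
then there are no positive roots either. -/
theorem not_possible_of_odd_signs {c : Config 6} (h0 : c.signs 0 = 1) (h1 : c.signs 1 = 1)
    (h3 : c.signs 3 = 1) (h5 : c.signs 5 = 1) (hP : 0 < c.pos) (hN : c.neg = 0) :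
    ¬ Possible c := by
  rintro ⟨Y, hY⟩
  have a0 := hY.coeff_pos 0 h0
  have a1 := hY.coeff_pos 1 h1
  have a3 := hY.coeff_pos 3 h3
  have a5 := hY.coeff_pos 5 h5
  have hY0 : Y ≠ 0 := by rintro rfl; simp at a0
  rw [← hY.2.2.1, numPos, Multiset.countP_pos] at hP
  obtain ⟨r, hr, hr0⟩ := hP
  rw [← hY.2.2.2, numNeg, Multiset.countP_eq_zero] at hN
  have ev : ∀ x : ℝ, Y.eval x = Y.coeff 0 + Y.coeff 1 * x + Y.coeff 2 * x ^ 2 +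
      Y.coeff 3 * x ^ 3 + Y.coeff 4 * x ^ 4 + Y.coeff 5 * x ^ 5 + Y.coeff 6 * x ^ 6 := by
    intro x
    rw [eval_eq_sum_range, hY.1]
    simp [Finset.sum_range_succ]
  have e1 : Y.eval r = 0 := (mem_roots'.1 hr).2
  have e2 : Y.eval (-r) ≤ 0 := by
    have t1 : 0 < Y.coeff 1 * r := mul_pos a1 hr0
    have t3 : 0 < Y.coeff 3 * r ^ 3 := mul_pos a3 (by positivity)
    have t5 : 0 < Y.coeff 5 * r ^ 5 := mul_pos a5 (by positivity)
    rw [ev] at e1 ⊢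
    -- `Y(-r) = Y(r) - 2 (a_1 r + a_3 r^3 + a_5 r^5)`.
    linear_combination e1 + 2 * (t1.le + t3.le + t5.le)
  have e3 : 0 < Y.eval 0 := by rw [← coeff_zero_eq_eval_zero]; exact a0
  obtain ⟨y, hy, hy0⟩ := intermediate_value_Icc (by linarith : -r ≤ 0)
    Y.continuous.continuousOn ⟨e2, e3.le⟩
  have hyn : y ≠ 0 := by rintro rfl; exact e3.ne' hy0
  exact hN y ((mem_roots hY0).2 hy0) (lt_of_le_of_ne hy.2 hyn)

theorem discrim_neg_of_roots_eq_zero {a b c : ℝ} (ha : a ≠ 0)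
    (h : (C a * X ^ 2 + C b * X + C c).roots = 0) : discrim a b c < 0 := by
  by_contra! hd
  obtain ⟨x, hx⟩ := exists_quadratic_eq_zero ha ⟨_, (Real.mul_self_sqrt hd).symm⟩
  have hq : C a * X ^ 2 + C b * X + C c ≠ 0 := by
    intro h0
    have := congrArg (fun p : ℝ[X] => p.coeff 2) h0
    simp at this
    exact ha this
  have : x ∈ (C a * X ^ 2 + C b * X + C c).roots := by
    rw [mem_roots hq, IsRoot.def]
    simp only [eval_add, eval_mul, eval_C, eval_pow, eval_X]
    linear_combination hx
  simp [h] at this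

theorem card_roots_eq {Y : ℝ[X]} (h0 : Y.coeff 0 ≠ 0) :
    Multiset.card Y.roots = numPos Y + numNeg Y := by
  rw [numPos, numNeg, Multiset.card_eq_countP_add_countP (fun x => 0 < x)]
  congr 1
  refine Multiset.countP_congr rfl fun x hx => ?_
  have : x ≠ 0 := by
    rintro rfl
    exact h0 (by rw [coeff_zero_eq_eval_zero]; exact (mem_roots'.1 hx).2)
  simp [this.le_iff_lt]

/-- Here `s, t, u, v` are the negated roots; `h5` and `h2` say that the coefficients of `x^5` and
`x^2` in the product are negative. With elementary symmetric functions `e_i`, they give `e1 e2 < 4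
e3`, while `e1 e2 ≥ 6 e3` for positive numbers. -/
theorem not_quadratic_mul_quartic {a b c s t u v : ℝ} (ha : 0 < a) (hs : 0 < s) (ht : 0 < t)
    (hu : 0 < u) (hv : 0 < v) (hd : discrim a b c < 0) (h5 : a * (s + t + u + v) + b < 0)
    (h2 : a * (s * t * u * v) + b * (s * t * u + s * t * v + s * u * v + t * u * v) +
      c * (s * t + s * u + s * v + t * u + t * v + u * v) < 0) : False := by
  set e1 := s + t + u + v with he1
  set e2 := s * t + s * u + s * v + t * u + t * v + u * v with he2
  set e3 := s * t * u + s * t * v + s * u * v + t * u * v with he3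
  have p2 : 0 < e2 := by positivity
  have p3 : 0 < e3 := by positivity
  have p4 : 0 < a * (s * t * u * v) := by positivity
  have p1 : 0 < a * e1 := by positivity
  have newton : 6 * e3 ≤ e1 * e2 := by
    have : 2 * (e1 * e2 - 6 * e3) = s * (t - u) ^ 2 + s * (t - v) ^ 2 + s * (u - v) ^ 2 +
        t * (s - u) ^ 2 + t * (s - v) ^ 2 + t * (u - v) ^ 2 + u * (s - t) ^ 2 + u * (s - v) ^ 2 +
        u * (t - v) ^ 2 + v * (s - t) ^ 2 + v * (s - u) ^ 2 + v * (t - u) ^ 2 := by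
      rw [he1, he2, he3]; ring
    have h : 0 ≤ 2 * (e1 * e2 - 6 * e3) := by rw [this]; positivity
    linarith
  rw [discrim] at hd
  -- Dropping the positive term `a e4` from `h2` leaves `c e2 < -b e3`; multiply by `4a` and use
  -- `b^2 < 4ac`.
  have k1 : b ^ 2 * e2 < 4 * a * (-b) * e3 := by nlinarith
  have k2 : (-b) * e2 < 4 * a * e3 := by
    have hb : 0 < -b := by linarith
    refine lt_of_mul_lt_mul_left (?_ : -b * (-b * e2) < -b * (4 * a * e3)) hb.le
    linarith
  -- `h5` says `a e1 < -b`; multiply by `e2` and chain with `k2`.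
  have k3 : a * (e1 * e2) < a * (4 * e3) := by nlinarith
  have k4 := lt_of_mul_lt_mul_left k3 ha.le
  linarith

theorem not_possible_zero_four :
    ¬ Possible (⟨![1, 1, -1, -1, -1, -1, 1], 0, 4⟩ : Config 6) := by
  rintro ⟨Y, hY⟩
  have a0 := hY.coeff_pos 0 rfl
  have a2 := hY.coeff_neg 2 rfl
  have a5 := hY.coeff_neg 5 rfl
  have a6 := hY.coeff_pos 6 rfl
  have hcard : Multiset.card Y.roots = 4 := by
    rw [card_roots_eq a0.ne', hY.2.2.1, hY.2.2.2]; rfl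
  have hneg : ∀ x ∈ Y.roots, x < 0 := by
    have h4 : Y.roots.countP (fun x => x < 0) = Multiset.card Y.roots := by
      rw [hcard]; exact hY.2.2.2
    exact Multiset.countP_eq_card.1 h4
  obtain ⟨q, hq, hdeg, hqr⟩ := exists_prod_multiset_X_sub_C_mul Y
  rw [hcard, hY.1] at hdeg
  obtain ⟨r1, r2, r3, r4, hr⟩ := Multiset.card_eq_four.1 hcard
  rw [hr] at hneg hq
  have n1 := hneg r1 (by simp)
  have n2 := hneg r2 (by simp)
  have n3 := hneg r3 (by simp)
  have n4 := hneg r4 (by simp)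
  have hq2 := eq_quadratic_of_degree_le_two (natDegree_le_iff_degree_le.1 (by omega : q.natDegree ≤ 2))
  generalize q.coeff 2 = a, q.coeff 1 = b, q.coeff 0 = c at hq2
  rw [hq2] at hq hqr
  -- The coefficients of `x^5` and `x^2` are written in the negated roots, to match the hypotheses
  -- of `not_quadratic_mul_quartic`.
  have hexp : Y = C a * X ^ 6 + C (a * (-r1 + -r2 + -r3 + -r4) + b) * X ^ 5 +
      C (a * (r1 * r2 + r1 * r3 + r1 * r4 + r2 * r3 + r2 * r4 + r3 * r4) -
        b * (r1 + r2 + r3 + r4) + c) * X ^ 4 +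
      C (-a * (r1 * r2 * r3 + r1 * r2 * r4 + r1 * r3 * r4 + r2 * r3 * r4) +
        b * (r1 * r2 + r1 * r3 + r1 * r4 + r2 * r3 + r2 * r4 + r3 * r4) -
        c * (r1 + r2 + r3 + r4)) * X ^ 3 +
      C (a * (-r1 * -r2 * -r3 * -r4) +
        b * (-r1 * -r2 * -r3 + -r1 * -r2 * -r4 + -r1 * -r3 * -r4 + -r2 * -r3 * -r4) +
        c * (-r1 * -r2 + -r1 * -r3 + -r1 * -r4 + -r2 * -r3 + -r2 * -r4 + -r3 * -r4)) * X ^ 2 +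
      C (b * (r1 * r2 * r3 * r4) -
        c * (r1 * r2 * r3 + r1 * r2 * r4 + r1 * r3 * r4 + r2 * r3 * r4)) * X +
      C (c * (r1 * r2 * r3 * r4)) := by
    rw [← hq]
    simp only [Multiset.insert_eq_cons, Multiset.map_cons, Multiset.map_singleton,
      Multiset.prod_cons, Multiset.prod_singleton, C_add, C_sub, C_mul, C_neg]
    ring
  rw [hexp] at a2 a5 a6
  simp only [coeff_add, coeff_C_mul, coeff_X_pow, coeff_X, coeff_C] at a2 a5 a6
  norm_num [Fin.val_ofNat] at a2 a5 a6
  refine not_quadratic_mul_quartic a6 (neg_pos.2 n1) (neg_pos.2 n2) (neg_pos.2 n3) (neg_pos.2 n4)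
    (discrim_neg_of_roots_eq_zero a6.ne' hqr) ?_ ?_
  · linarith
  · linarith

/-! ### Polynomials given by their linear and quadratic factors -/

/-- The polynomial with the given list of coefficients, constant term first. -/
noncomputable def ofCoeffs (l : List ℤ) : ℝ[X] := l.foldr (fun a p => C (a : ℝ) + X * p) 0

theorem ofCoeffs_nil : ofCoeffs [] = 0 := rfl

theorem ofCoeffs_cons (a : ℤ) (l : List ℤ) : ofCoeffs (a :: l) = C (a : ℝ) + X * ofCoeffs l := rfl

theorem coeff_ofCoeffs (l : List ℤ) (i : ℕ) : (ofCoeffs l).coeff i = (l.getD i 0 : ℤ) := by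
  induction l generalizing i with
  | nil => simp [ofCoeffs_nil]
  | cons a l ih =>
    rw [ofCoeffs_cons, coeff_add]
    cases i with
    | zero => rw [coeff_C_zero, mul_coeff_zero, coeff_X_zero, zero_mul, add_zero]; rfl
    | succ i => rw [coeff_C_succ, coeff_X_mul, ih, zero_add]; rfl

/-- Computable arithmetic on coefficient lists, so that signs of coefficients of a product can be
evaluated by the kernel. -/
def addCoeffs : List ℤ → List ℤ → List ℤ
  | [], m => m
  | l, [] => l
  | a :: l, b :: m => (a + b) :: addCoeffs l m

theorem ofCoeffs_addCoeffs (l m : List ℤ) :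
    ofCoeffs (addCoeffs l m) = ofCoeffs l + ofCoeffs m := by
  induction l, m using addCoeffs.induct with
  | case1 m => simp [addCoeffs, ofCoeffs_nil]
  | case2 l => cases l <;> simp [addCoeffs, ofCoeffs_nil]
  | case3 a l b m ih =>
    simp only [addCoeffs, ofCoeffs_cons, ih, Int.cast_add, C_add]
    ring

def mulCoeffs : List ℤ → List ℤ → List ℤ
  | [], _ => []
  | a :: l, m => addCoeffs (m.map (a * ·)) (0 :: mulCoeffs l m)

theorem ofCoeffs_map_mul (a : ℤ) (m : List ℤ) :
    ofCoeffs (m.map (a * ·)) = C (a : ℝ) * ofCoeffs m := by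
  induction m with
  | nil => simp [ofCoeffs_nil]
  | cons b m ih =>
    simp only [List.map_cons, ofCoeffs_cons, ih, Int.cast_mul, C_mul]
    ring

theorem ofCoeffs_mulCoeffs (l m : List ℤ) :
    ofCoeffs (mulCoeffs l m) = ofCoeffs l * ofCoeffs m := by
  induction l with
  | nil => simp [mulCoeffs, ofCoeffs_nil]
  | cons a l ih =>
    simp only [mulCoeffs, ofCoeffs_addCoeffs, ofCoeffs_map_mul, ofCoeffs_cons, ih, Int.cast_zero,
      C_0]
    ring

/-- A list of integral roots and a list of triples `(a, b, c)`, which stand for the quadratic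
factors `a x ^ 2 + b x + c`. -/
structure Factored where
  roots : List ℤ
  quads : List (ℤ × ℤ × ℤ)

namespace Factored

def linearCoeffs (r : ℤ) : List ℤ := [-r, 1]

def quadCoeffs (q : ℤ × ℤ × ℤ) : List ℤ := [q.2.2, q.2.1, q.1]

noncomputable def poly (f : Factored) : ℝ[X] :=
  (f.roots.map fun r : ℤ => X - C (r : ℝ)).prod *
    (f.quads.map fun q : ℤ × ℤ × ℤ => C (q.1 : ℝ) * X ^ 2 + C (q.2.1 : ℝ) * X + C (q.2.2 : ℝ)).prod

def coeffs (f : Factored) : List ℤ :=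
  (f.roots.map linearCoeffs).foldr mulCoeffs ((f.quads.map quadCoeffs).foldr mulCoeffs [1])

theorem ofCoeffs_coeffs (f : Factored) : ofCoeffs f.coeffs = f.poly := by
  have h : ∀ (l : List (List ℤ)) (m : List ℤ),
      ofCoeffs (l.foldr mulCoeffs m) = (l.map ofCoeffs).prod * ofCoeffs m := by
    intro l m
    induction l with
    | nil => simp
    | cons a l ih =>
      rw [List.foldr_cons, ofCoeffs_mulCoeffs, ih, List.map_cons, List.prod_cons, mul_assoc]
  have h1 : ofCoeffs [1] = 1 := by simp [ofCoeffs_cons, ofCoeffs_nil]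
  rw [coeffs, h, h, h1, mul_one, List.map_map, List.map_map, poly]
  refine congrArg₂ (· * ·) (congrArg List.prod (List.map_congr_left fun r _ => ?_))
    (congrArg List.prod (List.map_congr_left fun q _ => ?_))
  · simp only [Function.comp, linearCoeffs, ofCoeffs_cons, ofCoeffs_nil, Int.cast_neg, C_neg,
      Int.cast_one, C_1]
    ring
  · simp only [Function.comp, quadCoeffs, ofCoeffs_cons, ofCoeffs_nil]
    ring

/-- The quadratic factors have negative discriminants. -/
def Definite (f : Factored) : Prop := ∀ q ∈ f.quads, q.2.1 ^ 2 < 4 * q.1 * q.2.2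

instance (f : Factored) : Decidable f.Definite := by unfold Definite; infer_instance

theorem roots_poly {f : Factored} (hf : f.Definite) :
    f.poly.roots = ↑(f.roots.map (Int.cast : ℤ → ℝ)) := by
  have key : ∀ l : List (ℤ × ℤ × ℤ), (∀ q ∈ l, q.2.1 ^ 2 < 4 * q.1 * q.2.2) → ∀ x : ℝ,
      eval x (l.map fun q : ℤ × ℤ × ℤ => C (q.1 : ℝ) * X ^ 2 + C (q.2.1 : ℝ) * X +
        C (q.2.2 : ℝ)).prod ≠ 0 := by
    intro l hl x
    rw [eval_list_prod, List.map_map]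
    refine List.prod_ne_zero fun h => ?_
    obtain ⟨q, hq, h0⟩ := List.mem_map.1 h
    have h1 : ((q.2.1 : ℝ)) ^ 2 < 4 * q.1 * q.2.2 := by exact_mod_cast hl q hq
    simp only [Function.comp, eval_add, eval_mul, eval_C, eval_pow, eval_X] at h0
    -- Completing the square: at a zero the square `(2ax + b)^2` would equal the negative
    -- discriminant.
    have h2 : (2 * (q.1 : ℝ) * x + q.2.1) ^ 2 = (q.2.1 : ℝ) ^ 2 - 4 * q.1 * q.2.2 := by
      linear_combination 4 * (q.1 : ℝ) * h0
    linarith [sq_nonneg (2 * (q.1 : ℝ) * x + q.2.1)]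
  have hq0 := key f.quads hf
  set Q := (f.quads.map fun q : ℤ × ℤ × ℤ => C (q.1 : ℝ) * X ^ 2 + C (q.2.1 : ℝ) * X + C (q.2.2 : ℝ)).prod
    with hQ
  have hQr : Q.roots = 0 :=
    Multiset.eq_zero_of_forall_notMem fun x hx => hq0 x (mem_roots'.1 hx).2
  have hQ0 : Q ≠ 0 := fun h => hq0 0 (by rw [h, eval_zero])
  have hprod : (f.roots.map fun r : ℤ => X - C (r : ℝ)).prod =
      (((f.roots.map (Int.cast : ℤ → ℝ)) : Multiset ℝ).map fun a => X - C a).prod := by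
    simp [List.map_map, Function.comp_def]
  rw [poly, ← hQ, hprod, roots_mul, roots_multiset_prod_X_sub_C, hQr, add_zero]
  exact mul_ne_zero (monic_multiset_prod_of_monic _ _ fun a _ => monic_X_sub_C a).ne_zero hQ0

theorem numPos_poly {f : Factored} (hf : f.Definite) :
    numPos f.poly = f.roots.countP (fun r => 0 < r) := by
  rw [numPos, roots_poly hf, Multiset.coe_countP, List.countP_map]
  simp [Function.comp_def]

theorem numNeg_poly {f : Factored} (hf : f.Definite) :
    numNeg f.poly = f.roots.countP (fun r => r < 0) := by
  rw [numNeg, roots_poly hf, Multiset.coe_countP, List.countP_map]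
  simp [Function.comp_def]

end Factored

/-! ### Decidability -/

/-- A configuration as a list of signs and two numbers. -/
def Config.data {n : ℕ} (c : Config n) : List SignType × ℕ × ℕ := (List.ofFn c.signs, c.pos, c.neg)

theorem Config.data_injective {n : ℕ} : Function.Injective (Config.data (n := n)) := by
  intro c d h
  simp only [Config.data, Prod.mk.injEq] at h
  exact Config.ext (List.ofFn_injective h.1) h.2.1 h.2.2

instance {n : ℕ} : DecidableEq (Config n) := fun c d =>
  decidable_of_iff (c.data = d.data) Config.data_injective.eq_iff

instance {n : ℕ} (c : Config n) : Decidable (DescartesAllows c) := by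
  unfold DescartesAllows; infer_instance

def intSign (a : ℤ) : SignType := if 0 < a then 1 else if a < 0 then -1 else 0

theorem sign_intCast (a : ℤ) : SignType.sign (a : ℝ) = intSign a := by
  simp [sign_apply, intSign]

def Factored.data (f : Factored) : List SignType × ℕ × ℕ :=
  (f.coeffs.map intSign, f.roots.countP (fun r => 0 < r), f.roots.countP (fun r => r < 0))

/-- Turns realizability into an equality of computable data. The degree is exactly `n` because the
list has `n + 1` entries and its last sign is nonzero. -/
theorem Factored.realizes {n : ℕ} {f : Factored} {c : Config n} (hf : f.Definite)
    (hc : Gapless c) (h : c.data = f.data) : Realizes f.poly c := by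
  simp only [Config.data, Factored.data, Prod.mk.injEq] at h
  obtain ⟨hs, hP, hN⟩ := h
  have hlen : f.coeffs.length = n + 1 := by
    have := congrArg List.length hs
    rw [List.length_ofFn, List.length_map] at this
    exact this.symm
  have hsign : ∀ i : Fin (n + 1), SignType.sign (f.poly.coeff i) = c.signs i := by
    intro i
    have hi : (i : ℕ) < f.coeffs.length := by omega
    have h1 : (List.ofFn c.signs)[(i : ℕ)]? = (f.coeffs.map intSign)[(i : ℕ)]? := by rw [hs]
    rw [List.getElem?_eq_getElem (by rw [List.length_ofFn]; exact i.2), List.getElem?_eq_getElem (by simpa using hi)] at h1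
    simp only [List.getElem_ofFn, List.getElem_map, Option.some.injEq] at h1
    rw [← ofCoeffs_coeffs, coeff_ofCoeffs, List.getD_eq_getElem _ _ hi, h1, sign_intCast]
  refine ⟨natDegree_eq_of_le_of_coeff_ne_zero ?_ ?_, hsign, ?_, ?_⟩
  · rw [natDegree_le_iff_coeff_eq_zero]
    intro i hi
    rw [← ofCoeffs_coeffs, coeff_ofCoeffs, List.getD_eq_default _ _ (by omega), Int.cast_zero]
  · intro h0
    have := hsign (Fin.last n)
    rw [Fin.val_last, h0, sign_zero] at this
    exact hc _ this.symm
  · rw [numPos_poly hf, hP]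
  · rw [numNeg_poly hf, hN]

/-- All configurations that are obtained from `c` by trivial transformations. -/
def Config.orbit (c : Config 6) : List (Config 6) :=
  [c, c.negate, c.reflect, c.invert, c.negate.reflect, c.negate.invert, c.reflect.invert,
    c.negate.reflect.invert]

theorem Config.analogue_of_mem_orbit {c d : Config 6} (h : d ∈ c.orbit) : Config.Analogue c d := by
  have n : ∀ c : Config 6, Config.Analogue c c.negate := fun c => .single (.negate c)
  have r : ∀ c : Config 6, Config.Analogue c c.reflect := fun c => .single (.reflect c)
  have i : ∀ c : Config 6, Config.Analogue c c.invert := fun c => .single (.invert c)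
  simp only [Config.orbit, List.mem_cons, List.not_mem_nil, or_false] at h
  rcases h with rfl | rfl | rfl | rfl | rfl | rfl | rfl | rfl
  · exact .refl
  · exact n _
  · exact r _
  · exact i _
  · exact (n _).trans (r _)
  · exact (n _).trans (i _)
  · exact (r _).trans (i _)
  · exact ((n _).trans (r _)).trans (i _)

def exceptionalList : List (Config 6) := listed.flatMap Config.orbit

/-- In even degree the three involutions commute, so the eight products in `Config.orbit` form the
whole group they generate. -/
theorem exceptionalList_closed : ∀ c ∈ exceptionalList, c.negate ∈ exceptionalList ∧
    c.reflect ∈ exceptionalList ∧ c.invert ∈ exceptionalList := by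
  decide +kernel

theorem exceptional_iff {c : Config 6} : Exceptional c ↔ c ∈ exceptionalList := by
  constructor
  · rintro ⟨e, he, h⟩
    induction h with
    | refl => exact List.mem_flatMap.2 ⟨e, he, List.mem_cons_self⟩
    | tail _ hs ih =>
      cases hs with
      | negate => exact (exceptionalList_closed _ ih).1
      | reflect => exact (exceptionalList_closed _ ih).2.1
      | invert => exact (exceptionalList_closed _ ih).2.2
  · intro h
    obtain ⟨e, he, h⟩ := List.mem_flatMap.1 h
    exact ⟨e, he, Config.analogue_of_mem_orbit h⟩

/-! ### Realizing the other configurations -/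

/-- Up to trivial transformations, these realize every configuration of degree 6 that is allowed
by Descartes' rule and is not exceptional. -/
def witnesses : List Factored :=
  [⟨[], [(1, -6, 12), (1, 0, 10), (1, 7, 13)]⟩, ⟨[], [(1, -4, 5), (1, 1, 5), (1, 4, 5)]⟩,
   ⟨[], [(1, -3, 3), (1, -1, 6), (1, 5, 7)]⟩, ⟨[], [(1, -3, 3), (1, 0, 1), (1, 4, 5)]⟩,
   ⟨[], [(1, -3, 3), (1, 2, 2), (1, 2, 2)]⟩, ⟨[], [(1, -3, 4), (1, 1, 1), (1, 3, 3)]⟩,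
   ⟨[], [(1, -2, 2), (1, -1, 1), (1, 4, 5)]⟩, ⟨[], [(1, -2, 2), (1, 1, 1), (1, 2, 3)]⟩,
   ⟨[], [(1, -1, 1), (1, 0, 1), (1, 2, 4)]⟩, ⟨[], [(1, 0, 1), (1, 0, 1), (1, 1, 1)]⟩,
   ⟨[-5, -2], [(1, -1, 1), (1, -1, 1)]⟩, ⟨[-4, -3], [(1, -1, 1), (1, -1, 1)]⟩,
   ⟨[-4, -1], [(1, -2, 2), (1, 0, 3)]⟩, ⟨[-3, -2], [(1, -2, 2), (1, 1, 1)]⟩,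
   ⟨[-3, -2], [(1, -1, 1), (1, 0, 1)]⟩, ⟨[-3, -1], [(1, -2, 2), (1, -1, 2)]⟩,
   ⟨[-3, 1], [(1, 0, 1), (1, 0, 1)]⟩, ⟨[-3, 2], [(1, 0, 3), (1, 1, 1)]⟩,
   ⟨[-2, -1], [(1, -3, 3), (1, 1, 1)]⟩, ⟨[-2, -1], [(1, -3, 3), (1, 1, 3)]⟩,
   ⟨[-2, -1], [(1, -2, 2), (1, 0, 1)]⟩, ⟨[-2, -1], [(1, -1, 1), (1, -1, 1)]⟩,
   ⟨[-2, 1], [(1, -2, 2), (1, 2, 3)]⟩, ⟨[-2, 1], [(1, -2, 3), (1, 2, 2)]⟩,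
   ⟨[-2, 1], [(1, -1, 1), (1, 2, 3)]⟩, ⟨[-2, 1], [(1, 0, 1), (1, 0, 2)]⟩,
   ⟨[-2, 1], [(1, 0, 1), (1, 1, 1)]⟩, ⟨[-1, -1], [(1, 0, 1), (1, 0, 1)]⟩,
   ⟨[-1, 1], [(1, -1, 1), (1, 2, 3)]⟩, ⟨[-1, 2], [(1, -1, 1), (1, 3, 3)]⟩,
   ⟨[-1, 2], [(1, 1, 1), (1, 1, 1)]⟩, ⟨[1, 1], [(1, -1, 3), (1, 4, 5)]⟩,
   ⟨[1, 1], [(1, 0, 1), (1, 3, 3)]⟩, ⟨[1, 2], [(1, -1, 5), (1, 5, 7)]⟩,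
   ⟨[1, 2], [(1, 2, 2), (1, 2, 2)]⟩, ⟨[2, 2], [(1, 1, 1), (1, 4, 14)]⟩,
   ⟨[2, 2], [(1, 2, 2), (1, 3, 3)]⟩, ⟨[-9, 3, 3, 3], [(1, 1, 1)]⟩, ⟨[-8, 2, 3, 4], [(1, 2, 2)]⟩,
   ⟨[-6, -6, 2, 2], [(1, 1, 1)]⟩, ⟨[-6, -5, -4, -4], [(1, -1, 1)]⟩,
   ⟨[-5, -1, 2, 3], [(1, 0, 5)]⟩, ⟨[-4, -4, 1, 1], [(1, 0, 1)]⟩, ⟨[-4, -3, -3, 1], [(1, 0, 1)]⟩,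
   ⟨[-4, -1, 2, 2], [(1, 0, 1)]⟩, ⟨[-4, 1, 2, 2], [(1, 2, 2)]⟩, ⟨[-3, -3, -2, 1], [(1, -1, 1)]⟩,
   ⟨[-3, -2, -2, -2], [(1, -4, 5)]⟩, ⟨[-3, -2, -2, 2], [(1, -1, 1)]⟩,
   ⟨[-3, 1, 1, 1], [(1, 1, 1)]⟩, ⟨[-2, -2, -2, 1], [(1, -1, 1)]⟩, ⟨[-2, -2, 1, 1], [(1, -1, 1)]⟩,
   ⟨[-2, -2, 1, 1], [(1, 0, 1)]⟩, ⟨[-2, -1, -1, -1], [(1, -2, 2)]⟩,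
   ⟨[-2, -1, -1, 1], [(1, -1, 1)]⟩, ⟨[-2, -1, -1, 2], [(1, -1, 3)]⟩,
   ⟨[-2, -1, 1, 1], [(1, 0, 2)]⟩, ⟨[-2, 1, 1, 1], [(1, 2, 2)]⟩, ⟨[-1, -1, -1, -1], [(1, -3, 3)]⟩,
   ⟨[-1, -1, -1, -1], [(1, -3, 4)]⟩, ⟨[-1, -1, -1, -1], [(1, 0, 1)]⟩,
   ⟨[-1, -1, -1, 1], [(1, 0, 2)]⟩, ⟨[-1, -1, -1, 2], [(1, 0, 1)]⟩, ⟨[-1, -1, 1, 1], [(1, 1, 1)]⟩,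
   ⟨[-1, -1, 1, 1], [(1, 1, 3)]⟩, ⟨[1, 1, 1, 1], [(1, 5, 7)]⟩, ⟨[1, 1, 2, 2], [(1, 7, 13)]⟩,
   ⟨[-16, -1, 3, 4, 4, 5], []⟩, ⟨[-15, -1, -1, 5, 5, 6], []⟩, ⟨[-9, -8, -1, -1, 3, 3], []⟩,
   ⟨[-8, -8, -8, 1, 1, 1], []⟩, ⟨[-8, -7, 1, 1, 1, 1], []⟩, ⟨[-7, -2, -2, 1, 4, 5], []⟩,
   ⟨[-7, -1, -1, -1, 4, 5], []⟩, ⟨[-6, -1, 1, 1, 2, 2], []⟩, ⟨[-6, 1, 1, 1, 1, 1], []⟩,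
   ⟨[-5, -4, -1, 1, 1, 1], []⟩, ⟨[-4, -3, -2, 1, 1, 1], []⟩, ⟨[-4, -1, -1, 1, 2, 2], []⟩,
   ⟨[-3, -3, 1, 1, 1, 1], []⟩, ⟨[-3, -2, 1, 1, 1, 1], []⟩, ⟨[-2, -1, -1, -1, -1, 1], []⟩,
   ⟨[-2, -1, -1, 1, 1, 1], []⟩, ⟨[-1, -1, -1, -1, -1, -1], []⟩, ⟨[-1, -1, -1, -1, -1, 3], []⟩,
   ⟨[-1, -1, -1, -1, 1, 1], []⟩, ⟨[-1, -1, -1, -1, 1, 2], []⟩]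

theorem witnesses_definite : ∀ f ∈ witnesses, f.Definite := by
  decide +kernel

def factored₁ : Factored := ⟨[1, 2, 3, 4], [(1, 11, 31)]⟩

def factored₂ : Factored := ⟨[1, 2, 3, 4], [(2, 8, 9)]⟩

/-- Each of the six adjacent pairs is a variation in exactly one of `σ` and `σ'`. -/
theorem variations_add_variations_alternate (σ : Fin 7 → SignType) (hσ : ∀ i, σ i ≠ 0) :
    variations (List.ofFn σ) + variations (List.ofFn (alternate σ)) = 6 :=
  forall_gapless
    (Q := fun σ => variations (List.ofFn σ) + variations (List.ofFn (alternate σ)) = 6)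
    (by decide +kernel) σ hσ

/-- A property of the allowed gapless configurations of degree 6 can be checked on a finite
list of them. -/
theorem forall_allowed {Q : Config 6 → Prop}
    (h : ∀ a ∈ nonzeroSigns, ∀ b ∈ nonzeroSigns, ∀ c ∈ nonzeroSigns, ∀ d ∈ nonzeroSigns,
      ∀ e ∈ nonzeroSigns, ∀ f ∈ nonzeroSigns, ∀ g ∈ nonzeroSigns,
      ∀ v ∈ List.range 7, variations [a, b, c, d, e, f, g] = v →
      ∀ P ∈ List.range (v + 1), (v - P) % 2 = 0 →
      ∀ N ∈ List.range (7 - v), (6 - v - N) % 2 = 0 → Q ⟨![a, b, c, d, e, f, g], P, N⟩)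
    {c : Config 6} (hc : Gapless c) (ha : DescartesAllows c) : Q c := by
  obtain ⟨⟨hP, hP2⟩, hN, hN2⟩ := ha
  have hv := variations_add_variations_alternate c.signs hc
  have hw : variations (List.ofFn (alternate c.signs)) = 6 - variations (List.ofFn c.signs) := by
    omega
  rw [hw] at hN hN2
  exact forall_gapless (Q := fun σ => ∀ v ∈ List.range 7, variations (List.ofFn σ) = v →
      ∀ P ∈ List.range (v + 1), (v - P) % 2 = 0 →
      ∀ N ∈ List.range (7 - v), (6 - v - N) % 2 = 0 → Q ⟨σ, P, N⟩)
    h c.signs hc _ (List.mem_range.2 (by omega)) rfl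
    _ (List.mem_range.2 (by omega)) (Nat.even_iff.1 hP2)
    _ (List.mem_range.2 (by omega)) (Nat.even_iff.1 hN2)

/-- A hash of a list of signs and two numbers, which speeds up the search for a witness. -/
def hash (d : List SignType × ℕ × ℕ) : ℕ :=
  d.1.foldl (fun k s => match s with | .pos => 2 * k + 1 | _ => 2 * k) (7 * d.2.1 + d.2.2)

/-- Negation and then reflection make the two top signs positive, so only such orbit members are
searched for in the table. That condition and the hash only prune the kernel computation. -/
theorem exists_witness {c : Config 6} (hc : Gapless c) (ha : DescartesAllows c) :
    (∃ d ∈ c.orbit, d.signs 6 = 1 ∧ d.signs 5 = 1 ∧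
      ∃ f ∈ witnesses, hash f.data = hash d.data ∧ d.data = f.data) ∨ c ∈ exceptionalList :=
  forall_allowed (Q := fun c => (∃ d ∈ c.orbit, d.signs 6 = 1 ∧ d.signs 5 = 1 ∧
      ∃ f ∈ witnesses, hash f.data = hash d.data ∧ d.data = f.data) ∨ c ∈ exceptionalList)
    (by decide +kernel) hc ha

theorem possible_of_allowed {c : Config 6} (hc : Gapless c) (ha : DescartesAllows c)
    (he : ¬ Exceptional c) : Possible c := by
  rw [exceptional_iff] at he
  obtain ⟨d, hd, -, -, f, hf, -, hfd⟩ := (exists_witness hc ha).resolve_right he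
  have hcd := Config.analogue_of_mem_orbit hd
  have hg := hcd.gapless hc
  exact hcd.symm.possible hg ⟨f.poly, Factored.realizes (witnesses_definite f hf) hg hfd⟩

/-! ### The erasing rule -/

/-- Erase the entries of a list of signs at the positions that are marked `true`. -/
def erased : List Bool → List SignType → List SignType
  | m :: ms, s :: l => bif m then erased ms l else s :: erased ms l
  | _, _ => []

theorem erase_eq_erased {n : ℕ} (S : Finset (Fin (n + 1))) (σ : Fin (n + 1) → SignType) :
    erase S σ = erased (List.ofFn fun i => decide (i ∈ S)) (List.ofFn σ) := by
  rw [erase, List.ofFn_eq_map, List.ofFn_eq_map]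
  generalize List.finRange (n + 1) = l
  induction l with
  | nil => rfl
  | cons i l ih =>
    by_cases hi : i ∈ S
    · simp [erased, hi, ← ih]
    · simp [erased, hi, ← ih]

def signList (σ : Fin 7 → SignType) : List SignType := [σ 0, σ 1, σ 2, σ 3, σ 4, σ 5, σ 6]

def altList (σ : Fin 7 → SignType) : List SignType := [σ 0, -σ 1, σ 2, -σ 3, σ 4, -σ 5, σ 6]

theorem ofFn_eq_signList (σ : Fin 7 → SignType) : List.ofFn σ = signList σ := rfl

theorem ofFn_alternate (σ : Fin 7 → SignType) : List.ofFn (alternate σ) = altList σ := rfl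

/-- The marks of a set of indices that contains neither `0` nor `6`. -/
def innerMarks (m₁ m₂ m₃ m₄ m₅ : Bool) : List Bool := [false, m₁, m₂, m₃, m₄, m₅, false]

def bools : List Bool := [true, false]

theorem mem_bools (b : Bool) : b ∈ bools := by cases b <;> decide

def FollowsMarks (c : Config 6) (l : List Bool) : Prop :=
  c.pos = variations (erased l (signList c.signs)) ∧ c.neg = variations (erased l (altList c.signs))

instance (c : Config 6) (l : List Bool) : Decidable (FollowsMarks c l) := by
  unfold FollowsMarks; infer_instance

/-- Replaces the quantifier over sets of indices by five Booleans, which makes the rule cheap to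
enumerate. -/
theorem erasingRule_iff {c : Config 6} : ErasingRule c ↔
    ∃ m₁ ∈ bools, ∃ m₂ ∈ bools, ∃ m₃ ∈ bools, ∃ m₄ ∈ bools, ∃ m₅ ∈ bools,
      FollowsMarks c (innerMarks m₁ m₂ m₃ m₄ m₅) := by
  simp only [ErasingRule, erase_eq_erased, ofFn_eq_signList]
  constructor
  · rintro ⟨S, h0, h6, hP, hN⟩
    have h : (List.ofFn fun i => decide (i ∈ S)) = innerMarks (decide (1 ∈ S)) (decide (2 ∈ S))
        (decide (3 ∈ S)) (decide (4 ∈ S)) (decide (5 ∈ S)) := by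
      change [decide (0 ∈ S), _, _, _, _, _, decide (Fin.last 6 ∈ S)] = _
      rw [decide_eq_false h0, decide_eq_false h6]
      rfl
    rw [h] at hP hN
    exact ⟨_, mem_bools _, _, mem_bools _, _, mem_bools _, _, mem_bools _, _, mem_bools _, hP, hN⟩
  · rintro ⟨m₁, -, m₂, -, m₃, -, m₄, -, m₅, -, hP, hN⟩
    let f : Fin 7 → Bool := ![false, m₁, m₂, m₃, m₄, m₅, false]
    have h : (List.ofFn fun i => decide (i ∈ Finset.univ.filter fun i => f i = true)) =
        innerMarks m₁ m₂ m₃ m₄ m₅ := by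
      have : (fun i => decide (i ∈ Finset.univ.filter fun i => f i = true)) = f := by
        funext i; simp
      rw [this]; rfl
    refine ⟨Finset.univ.filter fun i => f i = true, by simp [f], by simp [f, Fin.last], ?_, ?_⟩
    · rw [h]; exact hP
    · rw [h]; exact hN

def AllowedCounts (σ : Fin 7 → SignType) (P N : ℕ) : Prop :=
  (P ≤ variations (signList σ) ∧ (variations (signList σ) - P) % 2 = 0) ∧
    (N ≤ variations (altList σ) ∧ (variations (altList σ) - N) % 2 = 0)

instance (σ : Fin 7 → SignType) (P N : ℕ) : Decidable (AllowedCounts σ P N) := by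
  unfold AllowedCounts; infer_instance

theorem descartesAllows_iff {c : Config 6} :
    DescartesAllows c ↔ AllowedCounts c.signs c.pos c.neg := by
  rw [DescartesAllows, AllowedCounts, Nat.even_iff, Nat.even_iff, ofFn_alternate, ofFn_eq_signList]

/-- Erasing an interior entry lowers the number of variations by 0 or 2; here this is confirmed by
enumeration. -/
theorem allowedCounts_erased (σ : Fin 7 → SignType) (hσ : ∀ i, σ i ≠ 0) :
    ∀ m₁ ∈ bools, ∀ m₂ ∈ bools, ∀ m₃ ∈ bools, ∀ m₄ ∈ bools, ∀ m₅ ∈ bools,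
      AllowedCounts σ (variations (erased (innerMarks m₁ m₂ m₃ m₄ m₅) (signList σ)))
        (variations (erased (innerMarks m₁ m₂ m₃ m₄ m₅) (altList σ))) :=
  forall_gapless (Q := fun σ =>
    ∀ m₁ ∈ bools, ∀ m₂ ∈ bools, ∀ m₃ ∈ bools, ∀ m₄ ∈ bools, ∀ m₅ ∈ bools,
      AllowedCounts σ (variations (erased (innerMarks m₁ m₂ m₃ m₄ m₅) (signList σ)))
        (variations (erased (innerMarks m₁ m₂ m₃ m₄ m₅) (altList σ))))
    (by decide +kernel) σ hσ

theorem ErasingRule.descartesAllows {c : Config 6} (h : ErasingRule c) (hc : Gapless c) :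
    DescartesAllows c := by
  obtain ⟨m₁, -, m₂, -, m₃, -, m₄, -, m₅, -, hP, hN⟩ := erasingRule_iff.1 h
  rw [descartesAllows_iff, hP, hN]
  exact allowedCounts_erased c.signs hc _ (mem_bools m₁) _ (mem_bools m₂) _ (mem_bools m₃)
    _ (mem_bools m₄) _ (mem_bools m₅)

theorem not_followsMarks_of_exceptional : ∀ c ∈ exceptionalList,
    ∀ m₁ ∈ bools, ∀ m₂ ∈ bools, ∀ m₃ ∈ bools, ∀ m₄ ∈ bools, ∀ m₅ ∈ bools,
      ¬ FollowsMarks c (innerMarks m₁ m₂ m₃ m₄ m₅) := by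
  decide +kernel

theorem ErasingRule.not_exceptional {c : Config 6} (h : ErasingRule c) : ¬ Exceptional c := by
  obtain ⟨m₁, -, m₂, -, m₃, -, m₄, -, m₅, -, hm⟩ := erasingRule_iff.1 h
  intro he
  exact not_followsMarks_of_exceptional c (exceptional_iff.1 he) _ (mem_bools m₁) _ (mem_bools m₂)
    _ (mem_bools m₃) _ (mem_bools m₄) _ (mem_bools m₅) hm

theorem erasing_or_factored {c : Config 6} (hc : Gapless c) (ha : DescartesAllows c) :
    (∃ m₁ ∈ bools, ∃ m₂ ∈ bools, ∃ m₃ ∈ bools, ∃ m₄ ∈ bools, ∃ m₅ ∈ bools,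
      FollowsMarks c (innerMarks m₁ m₂ m₃ m₄ m₅)) ∨
    (∃ d ∈ c.orbit, d.data = factored₁.data ∨ d.data = factored₂.data) ∨ c ∈ exceptionalList :=
  forall_allowed (Q := fun c =>
    (∃ m₁ ∈ bools, ∃ m₂ ∈ bools, ∃ m₃ ∈ bools, ∃ m₄ ∈ bools, ∃ m₅ ∈ bools,
      FollowsMarks c (innerMarks m₁ m₂ m₃ m₄ m₅)) ∨
    (∃ d ∈ c.orbit, d.data = factored₁.data ∨ d.data = factored₂.data) ∨ c ∈ exceptionalList)
    (by decide +kernel) hc ha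

/-! ### The two explicit polynomials and the main theorem -/

/-- Changing `i - X` to `X - i` in four factors leaves the product unchanged. -/
theorem explicitPoly₁_eq : explicitPoly₁ = factored₁.poly := by
  simp only [explicitPoly₁, Factored.poly, factored₁, List.map_cons, List.map_nil, List.prod_cons,
    List.prod_nil, Int.cast_ofNat, Int.cast_one, C_1, map_ofNat]
  ring

theorem explicitPoly₂_eq : explicitPoly₂ = factored₂.poly := by
  simp only [explicitPoly₂, Factored.poly, factored₂, List.map_cons, List.map_nil, List.prod_cons,
    List.prod_nil, Int.cast_ofNat, Int.cast_one, C_1, map_ofNat]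
  ring

theorem realizes_explicitPoly₁ {c : Config 6} (hc : Gapless c) (h : c.data = factored₁.data) :
    Realizes explicitPoly₁ c :=
  explicitPoly₁_eq ▸ Factored.realizes (by decide +kernel) hc h

theorem realizes_explicitPoly₂ {c : Config 6} (hc : Gapless c) (h : c.data = factored₂.data) :
    Realizes explicitPoly₂ c :=
  explicitPoly₂_eq ▸ Factored.realizes (by decide +kernel) hc h

theorem gapless_and_allowed_of_mem_exceptionalList : ∀ c ∈ exceptionalList,
    (∀ i, c.signs i ≠ 0) ∧ DescartesAllows c := by
  decide +kernel

theorem not_possible_of_mem_listed : ∀ e ∈ listed, ¬ Possible e := by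
  simp only [listed, List.forall_mem_cons]
  exact ⟨not_possible_of_odd_signs rfl rfl rfl rfl (by decide) rfl,
    not_possible_of_odd_signs rfl rfl rfl rfl (by decide) rfl,
    not_possible_of_odd_signs rfl rfl rfl rfl (by decide) rfl, not_possible_zero_four,
    fun _ h => absurd h List.not_mem_nil⟩

theorem Possible.not_exceptional {c : Config 6} (h : Possible c) (hc : Gapless c) :
    ¬ Exceptional c := fun ⟨e, he, hec⟩ =>
  not_possible_of_mem_listed e he (hec.symm.possible hc h)

end SignPatterns

theorem mainTheorem3 :
    -- a pair is possible iff it is allowed by Descartes' rule and is not an analogue of a listed one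
    (∀ c : SignPatterns.Config 6, SignPatterns.Gapless c →
      (SignPatterns.Possible c ↔
        SignPatterns.DescartesAllows c ∧ ¬ SignPatterns.Exceptional c)) ∧
    -- the listed impossibilities and their analogues are not predicted by Descartes' rule
    (∀ c : SignPatterns.Config 6, SignPatterns.Exceptional c →
      SignPatterns.Gapless c ∧ SignPatterns.DescartesAllows c) ∧
    -- whatever the erasing rule produces is possible
    (∀ c : SignPatterns.Config 6, SignPatterns.Gapless c → SignPatterns.ErasingRule c →
      SignPatterns.Possible c) ∧
    -- the two explicit polynomials
    SignPatterns.Realizes SignPatterns.explicitPoly₁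
      (⟨![1, -1, 1, 1, -1, 1, 1], 4, 0⟩ : SignPatterns.Config 6) ∧
    SignPatterns.Realizes SignPatterns.explicitPoly₂
      (⟨![1, -1, -1, 1, -1, -1, 1], 4, 0⟩ : SignPatterns.Config 6) ∧
    -- every other pair comes from the erasing rule or from one of these two polynomials
    (∀ c : SignPatterns.Config 6, SignPatterns.Gapless c →
      SignPatterns.DescartesAllows c → ¬ SignPatterns.Exceptional c →
        SignPatterns.ErasingRule c ∨
        ∃ Z : Polynomial ℝ,
          (SignPatterns.PolyAnalogue SignPatterns.explicitPoly₁ Z ∨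
            SignPatterns.PolyAnalogue SignPatterns.explicitPoly₂ Z) ∧
          SignPatterns.Realizes Z c) := by
  refine ⟨fun c hc => ⟨fun h => ⟨h.descartesAllows hc, h.not_exceptional hc⟩,
      fun h => SignPatterns.possible_of_allowed hc h.1 h.2⟩,
    fun c he => SignPatterns.gapless_and_allowed_of_mem_exceptionalList c
      (SignPatterns.exceptional_iff.1 he),
    -- The erasing rule follows from the classification: what it produces is allowed and not
    -- exceptional.
    fun c hc h => SignPatterns.possible_of_allowed hc (h.descartesAllows hc) h.not_exceptional,
    SignPatterns.realizes_explicitPoly₁ (by unfold SignPatterns.Gapless; decide)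
      (by decide +kernel),
    SignPatterns.realizes_explicitPoly₂ (by unfold SignPatterns.Gapless; decide)
      (by decide +kernel), fun c hc ha he => ?_⟩
  rcases SignPatterns.erasing_or_factored hc ha with h | ⟨d, hd, h⟩ | h
  · exact Or.inl (SignPatterns.erasingRule_iff.2 h)
  · right
    have hcd := SignPatterns.Config.analogue_of_mem_orbit hd
    have hg := hcd.gapless hc
    rcases h with h | h
    -- The explicit polynomial realizes the orbit member `d`; the reversed chain of transformations
    -- carries it to a realization of `c`.
    · obtain ⟨-, Z, hZ, hr⟩ :=
        hcd.symm.exists_polyAnalogue hg (SignPatterns.realizes_explicitPoly₁ hg h)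
      exact ⟨Z, Or.inl hZ, hr⟩
    · obtain ⟨-, Z, hZ, hr⟩ :=
        hcd.symm.exists_polyAnalogue hg (SignPatterns.realizes_explicitPoly₂ hg h)
      exact ⟨Z, Or.inr hZ, hr⟩
  · exact absurd (SignPatterns.exceptional_iff.2 h) he
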